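/- Let $p$ be a prime, $n$ a positive integer, $q = p^n$, and $\mathbb{F}_q$ a field with $q$ elements. A function $F : \mathbb{F}_q \to \mathbb{F}_q$ is called planar if for every non-zero $\alpha \in \mathbb{F}_q$ the map $x \mapsto F(x+\alpha) - F(x) - F(\alpha)$ is a permutation of $\mathbb{F}_q$. For a non-negative integer $e$, let $s_p(e)$ denote the sum of the digits of $e$ in base $p$. The algebraic degree of a non-zero function $H : \mathbb{F}_q \to \mathbb{F}_q$ is $$\deg_{\mathrm{alg}}(H) = \max\{\, s_p(i) : 0 \le i \le q-1,\ a_i \neq 0 \,\},$$ where $\sum_{i=0}^{q-1} a_i X^i$ is the unique polynomial of degree at most $q-1$ over $\mathbb{F}_q$ that agrees with $H$ at every point of $\mathbb{F}_q$; for the zero function put $\deg_{\mathrm{alg}}(0) = 0$. If $F$ is a planar function on $\mathbb{F}_q$, then for every non-zero function $G : \mathbb{F}_q \to \mathbb{F}_q$, $$\deg_{\mathrm{alg}}(G \circ F) - \deg_{\mathrm{alg}}(G) \le \frac{n(p-1)}{2}.$$ -/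

import Mathlib

open Polynomial

/-- `F : K → K` is planar if `x ↦ F (x + α) - F x - F α` is a permutation of `K` for every
non-zero `α`. -/
def IsPlanar {K : Type*} [Field K] (F : K → K) : Prop :=
  ∀ α : K, α ≠ 0 → Function.Bijective fun x : K => F (x + α) - F x - F α

open Classical in
/-- The unique polynomial of degree at most `q - 1` that agrees with `F` on the finite field `K`
of order `q`. -/
noncomputable def interpPoly {K : Type*} [Field K] [Fintype K] (F : K → K) : K[X] :=
  Lagrange.interpolate Finset.univ id F

/-- The polynomial `interpPoly F` has degree less than `q` and evaluates to `F`, and it is the only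
such polynomial. -/
theorem eq_interpPoly_iff {K : Type*} [Field K] [Fintype K] (F : K → K) (f : K[X]) :
    f = interpPoly F ↔ f.degree < Fintype.card K ∧ ∀ x : K, f.eval x = F x := by
  classical
  have h := Lagrange.eq_interpolate_iff (s := (Finset.univ : Finset K)) (v := id) (r := F) (f := f)
    Function.injective_id.injOn
  rw [interpPoly]
  simp only [Finset.mem_univ, true_imp_iff, id, Finset.card_univ] at h
  convert h.symm using 2

/-- The sum of the digits of `e` in base `p`. -/
def digitSum (p e : ℕ) : ℕ := (Nat.digits p e).sum

/-- The algebraic degree of `F : K → K`, where `K` is a finite field of characteristic `p`: the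
largest base-`p` digit sum of an exponent with non-zero coefficient in the interpolating polynomial
of `F`. The zero function, which has no such exponent, gets the value `0`. -/
noncomputable def algDeg (p : ℕ) {K : Type*} [Field K] [Fintype K] (F : K → K) : ℕ :=
  (interpPoly F).support.sup (digitSum p)

/-! For `i > 0`, the coefficient of `X ^ i` in `G ∘ F` is `-∑ G (F x) x ^ (q - 1 - i)`, and `q - 1 -
i` has digit sum `n(p - 1) - s_p(i)`. So it suffices that `∑ F x ^ k * x ^ j = 0` whenever `s_p(j) +
s_p(k) < n(p - 1)/2`. Each such summand is a product of that many additive forms on the graph of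
`F`. Planarity makes `q` divide `z * σ z` for every character sum `z` over the graph, where `σ`
inverts `ζ`. As `(ζ - 1) ^ (p - 1)` divides `p`, at least half of `n(p - 1)` factors `ζ - 1` divide
`z` (`sub_one_pow_dvd_sum`). Since `ζ ^ m - 1` is `m (ζ - 1)` to first order, expanding a product of
such factors into character sums forces short products of forms to sum to zero
(`sum_prod_eq_zero_of_sub_one_pow_dvd`). -/

section DigitSum

theorem digitSum_zero (p : ℕ) : digitSum p 0 = 0 := by
  simp [digitSum]

theorem digitSum_eq_mod_add_div {p : ℕ} (hp : 1 < p) (e : ℕ) :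
    digitSum p e = e % p + digitSum p (e / p) := by
  rcases Nat.eq_zero_or_pos e with rfl | he
  · simp [digitSum]
  · simp [digitSum, Nat.digits_def' hp he]

/-- All `n` digits of `p ^ n - 1` are `p - 1`, so `a` and `b` add without carries. -/
theorem digitSum_add_digitSum {p : ℕ} (hp : 1 < p) (n : ℕ) :
    ∀ a b : ℕ, a + b + 1 = p ^ n → digitSum p a + digitSum p b = n * (p - 1) := by
  induction n with
  | zero =>
    intro a b h
    obtain ⟨rfl, rfl⟩ : a = 0 ∧ b = 0 := by simp at h; omega
    simp [digitSum]
  | succ n ih =>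
    intro a b h
    have ha := Nat.div_add_mod a p
    have hb := Nat.div_add_mod b p
    have hap := Nat.mod_lt a (by omega : p > 0)
    have hbp := Nat.mod_lt b (by omega : p > 0)
    have hdvd : p ∣ a % p + b % p + 1 := by
      have h1 : p ∣ a + b + 1 := h ▸ dvd_pow_self p n.succ_ne_zero
      have h2 : a + b + 1 = p * (a / p + b / p) + (a % p + b % p + 1) := by
        rw [Nat.mul_add]; omega
      rw [h2] at h1
      exact (Nat.dvd_add_right (dvd_mul_right _ _)).1 h1
    have hmod : a % p + b % p + 1 = p := by
      obtain ⟨c, hc⟩ := hdvd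
      have : c = 1 := by
        have h1 : c < 2 := by
          by_contra h2
          have := Nat.mul_le_mul_left p (not_lt.1 h2)
          omega
        have h0 : c ≠ 0 := by rintro rfl; omega
        omega
      rw [hc, this, mul_one]
    have hdiv : a / p + b / p + 1 = p ^ n := by
      apply Nat.eq_of_mul_eq_mul_left (by omega : 0 < p)
      rw [← pow_succ', ← h, Nat.mul_add, Nat.mul_add]
      omega
    have := ih _ _ hdiv
    rw [digitSum_eq_mod_add_div hp a, digitSum_eq_mod_add_div hp b, Nat.succ_mul]
    omega

/-- In characteristic `p`, the monomial `x ^ e` is a product of `digitSum p e` additive maps. -/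
theorem exists_list_addMonoidHom_pow {p : ℕ} (hp : p.Prime) {K : Type*} [Field K] [CharP K p]
    (e : ℕ) : ∃ l : List (K →+ K), l.length = digitSum p e ∧
      ∀ x : K, x ^ e = (l.map fun φ => φ x).prod := by
  have : Fact p.Prime := ⟨hp⟩
  induction e using Nat.strong_induction_on with
  | _ e ih =>
    rcases Nat.eq_zero_or_pos e with rfl | he
    · exact ⟨[], by simp [digitSum], by simp⟩
    · obtain ⟨l, hl, hprod⟩ := ih (e / p) (Nat.div_lt_self he hp.one_lt)
      -- The lowest digit contributes copies of the identity; the higher ones are Frobenius twists.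
      refine ⟨List.replicate (e % p) (AddMonoidHom.id K) ++
        l.map fun φ => (frobenius K p).toAddMonoidHom.comp φ, ?_, fun x => ?_⟩
      · rw [digitSum_eq_mod_add_div hp.one_lt e]
        simp [hl]
      · have hfrob : (l.map fun φ => (frobenius K p) (φ x)).prod = (x ^ (e / p)) ^ p := by
          rw [hprod x, ← frobenius_def, map_list_prod, List.map_map]
          rfl
        conv_lhs => rw [← Nat.mod_add_div e p]
        simp [List.map_map, Function.comp_def, hfrob, pow_add, pow_mul, mul_comm p]

end DigitSum

section Coefficients

variable {K : Type*} [Field K] [Fintype K]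

theorem sum_pow_eq_ite_of_lt {k : ℕ} (hk : k < 2 * (Fintype.card K - 1)) :
    ∑ x : K, x ^ k = if k = Fintype.card K - 1 then -1 else 0 := by
  classical
  have hq : 1 < Fintype.card K := Fintype.one_lt_card
  split_ifs with h
  · have h1 : ∀ x : K, x ^ k = 1 - if x = 0 then 1 else 0 := by
      intro x
      split_ifs with hx
      · rw [hx, zero_pow (by omega), sub_self]
      · rw [h, FiniteField.pow_card_sub_one_eq_one x hx, sub_zero]
    simp [h1]
  · rcases lt_or_ge k (Fintype.card K - 1) with h1 | h1
    · exact FiniteField.sum_pow_lt_card_sub_one K k h1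
    -- `x ^ q = x` lowers the exponent by `q - 1`; it stays positive, so `x = 0` is covered.
    · rw [← FiniteField.sum_pow_lt_card_sub_one K (k - (Fintype.card K - 1)) (by omega)]
      refine Finset.sum_congr rfl fun x _ => ?_
      have h2 : k = Fintype.card K + (k - Fintype.card K) := by omega
      have h3 : k - (Fintype.card K - 1) = 1 + (k - Fintype.card K) := by omega
      rw [h3]
      conv_lhs => rw [h2]
      rw [pow_add, FiniteField.pow_card, pow_add, pow_one]

theorem interpPoly_degree_lt (H : K → K) : (interpPoly H).degree < Fintype.card K :=
  ((eq_interpPoly_iff H _).1 rfl).1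

theorem eval_interpPoly (H : K → K) (x : K) : (interpPoly H).eval x = H x :=
  ((eq_interpPoly_iff H _).1 rfl).2 x

theorem eq_sum_coeff_interpPoly (H : K → K) (x : K) :
    H x = ∑ k ∈ (interpPoly H).support, (interpPoly H).coeff k * x ^ k := by
  conv_lhs => rw [← eval_interpPoly H x, eval_eq_sum, Polynomial.sum]

theorem lt_card_of_mem_support_interpPoly {H : K → K} {k : ℕ}
    (hk : k ∈ (interpPoly H).support) : k < Fintype.card K := by
  have := (le_degree_of_mem_supp k hk).trans_lt (interpPoly_degree_lt H)
  exact_mod_cast this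

/-- Orthogonality of power sums. At `i = 0` it fails: then `k = q - 1` would contribute as well. -/
theorem coeff_interpPoly {H : K → K} {i j : ℕ} (hi : 0 < i) (hij : i + j + 1 = Fintype.card K) :
    (interpPoly H).coeff i = -∑ x : K, H x * x ^ j := by
  have h : ∀ k ∈ (interpPoly H).support,
      ∑ x : K, (interpPoly H).coeff k * x ^ k * x ^ j
        = if k = i then -(interpPoly H).coeff i else 0 := by
    intro k hk
    have := lt_card_of_mem_support_interpPoly hk
    simp_rw [mul_assoc, ← pow_add]
    rw [← Finset.mul_sum, sum_pow_eq_ite_of_lt (by omega)]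
    by_cases hki : k = i
    · subst hki
      rw [if_pos (by omega), if_pos rfl, mul_neg_one]
    · rw [if_neg (by omega), if_neg hki, mul_zero]
  simp_rw [eq_sum_coeff_interpPoly H, Finset.sum_mul]
  rw [Finset.sum_comm, Finset.sum_congr rfl h, Finset.sum_ite_eq']
  split_ifs with hs
  · rw [neg_neg]
  · rw [notMem_support_iff.1 hs, neg_zero]

end Coefficients

/-! ### Expansion of characters in powers of `ζ - 1` -/

section CharacterExpansion

variable {p : ℕ} {R : Type*} [CommRing R] {ζ : R} (hζ : IsPrimitiveRoot ζ p)

/-- A factor `ψ (m) - 1` gives the difference of the sums twisted by `ℓ + m` and `ℓ`, hence the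
general `ℓ`. -/
theorem sub_one_pow_dvd_sum_mul_prod [NeZero p] {X : Type*} [Fintype X] {A : Type*}
    [AddCommGroup A] (v : X → A) {r : ℕ}
    (h : ∀ ℓ : A →+ ZMod p, (ζ - 1) ^ r ∣ ∑ x, AddChar.zmodChar p hζ.pow_eq_one (ℓ (v x)))
    (M : List (A →+ ZMod p)) (ℓ : A →+ ZMod p) :
    (ζ - 1) ^ r ∣ ∑ x, AddChar.zmodChar p hζ.pow_eq_one (ℓ (v x)) *
      (M.map fun m => AddChar.zmodChar p hζ.pow_eq_one (m (v x)) - 1).prod := by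
  induction M generalizing ℓ with
  | nil => simpa using h ℓ
  | cons m M ih =>
    convert dvd_sub (ih (ℓ + m)) (ih ℓ) using 1
    rw [← Finset.sum_sub_distrib]
    refine Finset.sum_congr rfl fun x _ => ?_
    rw [List.map_cons, List.prod_cons, AddMonoidHom.add_apply, AddChar.map_add_eq_mul]
    ring

theorem exists_pow_eq_one_add_mul (a : R) (k : ℕ) :
    ∃ w, a ^ k - 1 = (a - 1) * (k + (a - 1) * w) := by
  induction k with
  | zero => exact ⟨0, by simp⟩
  | succ k ih =>
    obtain ⟨w, hw⟩ := ih
    refine ⟨a * w + k, ?_⟩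
    push_cast
    linear_combination a * hw

theorem exists_prod_zmodChar_sub_one [NeZero p] (M : List (ZMod p)) :
    ∃ w, (M.map fun m => AddChar.zmodChar p hζ.pow_eq_one m - 1).prod
      = (ζ - 1) ^ M.length * (((M.map ZMod.val).prod : ℕ) + (ζ - 1) * w) := by
  induction M with
  | nil => exact ⟨0, by simp⟩
  | cons m M ih =>
    obtain ⟨w, hw⟩ := ih
    obtain ⟨u, hu⟩ := exists_pow_eq_one_add_mul ζ m.val
    refine ⟨m.val * w + u * ((M.map ZMod.val).prod : ℕ) + (ζ - 1) * u * w, ?_⟩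
    rw [List.map_cons, List.prod_cons, hw, AddChar.zmodChar_apply, hu]
    simp only [List.length_cons, List.map_cons, List.prod_cons, Nat.cast_mul]
    ring

end CharacterExpansion

/-! ### Divisibility of character sums over the graph -/

section CharacterSums

variable {p : ℕ} {K : Type*} [Field K] [Fintype K] {R : Type*} [CommRing R] [IsDomain R]

/-- The sum of an additive character over the graph of a planar function, times the conjugate sum,
is a multiple of the order of the field. -/
theorem card_dvd_sum_mul_sum_inv {F : K → K} (hF : IsPlanar F) (χ : AddChar (K × K) R) :
    (Fintype.card K : R) ∣ (∑ x, χ (x, F x)) * ∑ x, χ (-(x, F x)) := by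
  classical
  let β : AddChar K R := χ.compAddMonoidHom (AddMonoidHom.inr K K)
  -- If `β` is trivial, the first factor is a full character sum over `K`, so `0` or `q`. Otherwise,
  -- grouping pairs by their difference `a`, planarity kills every `a ≠ 0`, and `a = 0` gives `q`.
  by_cases hβ : β = 0
  · let α : AddChar K R := χ.compAddMonoidHom (AddMonoidHom.inl K K)
    have h : ∀ x, χ (x, F x) = α x := by
      intro x
      have h1 : (x, F x) = (x, 0) + (0, F x) := by simp
      have h2 : χ (0, F x) = 1 := DFunLike.congr_fun hβ (F x)
      rw [h1, AddChar.map_add_eq_mul, h2, mul_one]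
      rfl
    simp_rw [h]
    refine Dvd.dvd.mul_right ?_ _
    rw [AddChar.sum_eq_ite]
    split_ifs
    · exact dvd_rfl
    · exact dvd_zero _
  · have h : ∀ a y : K, χ (a + y, F (a + y)) * χ (-(y, F y))
        = χ (a, F a) * β (F (y + a) - F y - F a) := by
      intro a y
      change _ = χ (a, F a) * χ (0, F (y + a) - F y - F a)
      rw [← AddChar.map_add_eq_mul, ← AddChar.map_add_eq_mul, add_comm a y]
      congr 1
      ext <;> simp [sub_eq_add_neg]
    have hsum : (∑ x, χ (x, F x)) * ∑ x, χ (-(x, F x))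
        = ∑ a : K, ∑ y : K, χ (a + y, F (a + y)) * χ (-(y, F y)) := by
      rw [Finset.sum_mul_sum, Finset.sum_comm]
      conv_rhs => rw [Finset.sum_comm]
      refine Finset.sum_congr rfl fun y _ => ?_
      exact (Fintype.sum_equiv (Equiv.addRight y) _ _ fun _ => rfl).symm
    rw [hsum]
    refine Finset.dvd_sum fun a _ => ?_
    by_cases ha : a = 0
    · subst ha
      have : ∀ y : K, χ (0 + y, F (0 + y)) * χ (-(y, F y)) = 1 := by
        intro y
        rw [← AddChar.map_add_eq_mul, zero_add, add_neg_cancel, AddChar.map_zero_eq_one]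
      simp_rw [this]
      simp
    · simp_rw [h]
      rw [← Finset.mul_sum, (hF a ha).sum_comp β, AddChar.sum_eq_ite, if_neg hβ, mul_zero]
      exact dvd_zero _

variable {ζ : R} (hζ : IsPrimitiveRoot ζ p)

/-- If `ζ - 1` is prime and some automorphism inverts `ζ`, every character sum over the graph of a
planar function is divisible by at least half the power of `ζ - 1` dividing the order. -/
theorem sub_one_pow_dvd_sum [NeZero p] (hprime : Prime (ζ - 1)) (σ : R ≃+* R)
    (hσ : σ ζ * ζ = 1) {n : ℕ} (hK : Fintype.card K = p ^ n) {F : K → K} (hF : IsPlanar F)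
    {r : ℕ} (hr : 2 * r ≤ n * (p - 1) + 1) (ℓ : K × K →+ ZMod p) :
    (ζ - 1) ^ r ∣ ∑ x, AddChar.zmodChar p hζ.pow_eq_one (ℓ (x, F x)) := by
  set ψ := AddChar.zmodChar p hζ.pow_eq_one with hψ
  have hσψ : ∀ c, σ (ψ c) = ψ (-c) := by
    intro c
    have h1 : σ (ψ c) * ψ c = 1 := by
      rw [hψ, AddChar.zmodChar_apply, map_pow, ← mul_pow, hσ, one_pow]
    have h2 : ψ (-c) * ψ c = 1 := by
      rw [← AddChar.map_add_eq_mul, neg_add_cancel, AddChar.map_zero_eq_one]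
    have h3 : ψ c ≠ 0 := right_ne_zero_of_mul_eq_one h1
    exact mul_right_cancel₀ h3 (h1.trans h2.symm)
  set z := ∑ x, ψ (ℓ (x, F x)) with hz
  have hσz : σ z = ∑ x, ψ (-ℓ (x, F x)) := by
    rw [hz, map_sum]
    exact Finset.sum_congr rfl fun x _ => hσψ _
  have hdvd : (ζ - 1) ^ (n * (p - 1)) ∣ z * σ z := by
    have h1 := card_dvd_sum_mul_sum_inv hF (ψ.compAddMonoidHom ℓ)
    simp only [AddChar.compAddMonoidHom_apply, map_neg] at h1
    rw [hσz]
    refine dvd_trans ?_ h1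
    rw [hK, Nat.cast_pow, mul_comm, pow_mul]
    obtain ⟨w, -, hw⟩ := hζ.self_sub_one_pow_dvd_order (Nat.sub_lt (NeZero.pos p) one_pos)
    exact pow_dvd_pow_of_dvd (Dvd.intro_left w hw.symm) n
  -- Hence `z` and `σ z` contain equally many factors `ζ - 1`.
  have hassoc : Associated (σ (ζ - 1)) (ζ - 1) := by
    have hu : IsUnit (-ζ) := (IsUnit.of_mul_eq_one_right _ hσ).neg
    refine ⟨hu.unit, ?_⟩
    rw [IsUnit.unit_spec, map_sub, map_one]
    linear_combination -hσ
  have hmul : emultiplicity (ζ - 1) (σ z) = emultiplicity (ζ - 1) z := by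
    rw [emultiplicity_eq_of_associated_left hassoc]
    exact emultiplicity_map_eq σ
  rw [pow_dvd_iff_le_emultiplicity, emultiplicity_mul hprime, hmul] at hdvd
  rw [pow_dvd_iff_le_emultiplicity]
  generalize emultiplicity (ζ - 1) z = m at hdvd
  induction m using ENat.recTopCoe with
  | top => exact le_top
  | coe m =>
    -- Integrality rounds up: `2 * m ≥ 2 * r - 1` gives `m ≥ r`.
    norm_cast at hdvd ⊢
    omega

/-- If all character sums over a family of points are divisible by `(ζ - 1) ^ r`, then products of
fewer than `r` linear forms sum to zero over that family. -/
theorem sum_prod_eq_zero_of_sub_one_pow_dvd [NeZero p] (hp : p.Prime) (hprime : Prime (ζ - 1)) {X : Type*}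
    [Fintype X] {A : Type*} [AddCommGroup A] (v : X → A) {r : ℕ}
    (h : ∀ ℓ : A →+ ZMod p, (ζ - 1) ^ r ∣ ∑ x, AddChar.zmodChar p hζ.pow_eq_one (ℓ (v x)))
    (M : List (A →+ ZMod p)) (hM : M.length < r) :
    ∑ x, (M.map fun m => m (v x)).prod = 0 := by
  choose w hw using fun x => exists_prod_zmodChar_sub_one hζ (M.map fun m => m (v x))
  have h1 := sub_one_pow_dvd_sum_mul_prod hζ v h M 0
  simp only [AddMonoidHom.zero_apply, AddChar.map_zero_eq_one, one_mul] at h1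
  simp only [List.map_map, List.length_map, Function.comp_def] at hw
  simp_rw [hw] at h1
  rw [← Finset.mul_sum] at h1
  have h2 := (pow_dvd_pow (ζ - 1) hM).trans h1
  rw [pow_succ, mul_dvd_mul_iff_left (pow_ne_zero _ hprime.ne_zero), Finset.sum_add_distrib,
    ← Finset.mul_sum, dvd_add_left (dvd_mul_right _ _), ← Nat.cast_sum] at h2
  have h3 : p ∣ ∑ x, (M.map fun m => (m (v x)).val).prod := by
    -- `ζ - 1` divides both `p` and this integer; were they coprime, it would be a unit.
    by_contra hnd
    have hcop := Nat.isCoprime_iff_coprime.2 ((Nat.Prime.coprime_iff_not_dvd hp).2 hnd)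
    obtain ⟨a, b, hab⟩ := hcop
    have hab' := congrArg (Int.cast : ℤ → R) hab
    rw [Int.cast_add, Int.cast_mul, Int.cast_mul, Int.cast_natCast, Int.cast_natCast,
      Int.cast_one] at hab'
    have hpdvd : (ζ - 1) ∣ (p : R) := by
      obtain ⟨w, -, hw⟩ := hζ.self_sub_one_pow_dvd_order hp.one_lt
      exact Dvd.intro_left w (by rw [hw, pow_one])
    refine hprime.not_isUnit (isUnit_of_dvd_one ?_)
    have hdvd := dvd_add (hpdvd.mul_left (a : R)) (h2.mul_left (b : R))
    rwa [hab'] at hdvd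
  have h4 := (ZMod.natCast_eq_zero_iff _ p).2 h3
  rw [Nat.cast_sum] at h4
  rw [← h4]
  refine Finset.sum_congr rfl fun x _ => ?_
  rw [Nat.cast_list_prod, List.map_map]
  simp [Function.comp_def]

end CharacterSums

open NumberField in
theorem exists_ringEquiv_inv_zeta (p : ℕ) [Fact p.Prime] (L : Type*) [Field L] [CharZero L]
    [IsCyclotomicExtension {p} ℚ L] :
    ∃ (ζ : 𝓞 L) (σ : 𝓞 L ≃+* 𝓞 L), IsPrimitiveRoot ζ p ∧ Prime (ζ - 1) ∧ σ ζ * ζ = 1 := by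
  have hζ := IsCyclotomicExtension.zeta_spec p ℚ L
  have hirr : Irreducible (cyclotomic p ℚ) :=
    cyclotomic.irreducible_rat (Fact.out : p.Prime).pos
  have hτ := IsCyclotomicExtension.fromZetaAut_spec hζ.inv hirr
  set τ := IsCyclotomicExtension.fromZetaAut hζ.inv hirr
  refine ⟨hζ.toInteger, RingOfIntegers.mapRingEquiv τ.toRingEquiv,
    hζ.toInteger_isPrimitiveRoot, hζ.zeta_sub_one_prime', RingOfIntegers.ext ?_⟩
  change τ (IsCyclotomicExtension.zeta p ℚ L) * IsCyclotomicExtension.zeta p ℚ L = 1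
  rw [hτ]
  exact inv_mul_cancel₀ (hζ.ne_zero (NeZero.ne p))

/-! ### Vanishing power sums and the degree bound -/

section Planar

variable {p n : ℕ} {K : Type*} [Field K] [Fintype K]

theorem IsPlanar.sum_prod_linearForms_eq_zero (hp : p.Prime) (hK : Fintype.card K = p ^ n)
    {F : K → K} (hF : IsPlanar F) (M : List (K × K →+ ZMod p))
    (hM : 2 * M.length < n * (p - 1)) :
    ∑ x, (M.map fun m => m (x, F x)).prod = 0 := by
  have : Fact p.Prime := ⟨hp⟩
  have : IsCyclotomicExtension {p} ℚ (CyclotomicField p ℚ) := by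
    convert! CyclotomicField.isCyclotomicExtension p ℚ
  obtain ⟨ζ, σ, hζ, hprime, hσ⟩ := exists_ringEquiv_inv_zeta p (CyclotomicField p ℚ)
  exact sum_prod_eq_zero_of_sub_one_pow_dvd hζ hp hprime (fun x => (x, F x))
    (sub_one_pow_dvd_sum hζ hprime σ hσ hK hF (r := M.length + 1) (by omega)) M
    (Nat.lt_succ_self _)

theorem IsPlanar.sum_prod_addMonoidHom_eq_zero (hp : p.Prime) [Algebra (ZMod p) K]
    (hK : Fintype.card K = p ^ n) {F : K → K} (hF : IsPlanar F) (L : List (K × K →+ K))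
    (hL : 2 * L.length < n * (p - 1)) :
    ∑ x, (L.map fun φ => φ (x, F x)).prod = 0 := by
  have : Fact p.Prime := ⟨hp⟩
  -- The induction trades each `K`-valued form for its coordinates over `ZMod p`, collected in `M`.
  suffices h : ∀ M : List (K × K →+ ZMod p), 2 * (L.length + M.length) < n * (p - 1) →
      ∑ x, (L.map fun φ => φ (x, F x)).prod *
        algebraMap (ZMod p) K (M.map fun m => m (x, F x)).prod = 0 by
    simpa using h [] (by simpa using hL)
  clear hL
  induction L with
  | nil =>
    intro M hM
    simp only [List.map_nil, List.prod_nil, one_mul]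
    rw [← map_sum, hF.sum_prod_linearForms_eq_zero hp hK M (by simpa using hM), map_zero]
  | cons φ L ih =>
    intro M hM
    have : Module.Finite (ZMod p) K := Module.Finite.of_finite
    let b := Module.finBasis (ZMod p) K
    have hb : ∀ y : K, y = ∑ i, algebraMap (ZMod p) K (b.coord i y) * b i := by
      intro y
      conv_lhs => rw [← b.sum_repr y]
      simp [Algebra.smul_def]
    have hterm : ∀ x, ((φ :: L).map fun φ => φ (x, F x)).prod *
        algebraMap (ZMod p) K (M.map fun m => m (x, F x)).prod
        = ∑ i, b i * ((L.map fun φ => φ (x, F x)).prod * algebraMap (ZMod p) K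
          ((((b.coord i).toAddMonoidHom.comp φ) :: M).map fun m => m (x, F x)).prod) := by
      intro x
      simp only [List.map_cons, List.prod_cons, map_mul]
      conv_lhs => rw [hb (φ (x, F x))]
      rw [Finset.sum_mul, Finset.sum_mul]
      refine Finset.sum_congr rfl fun i _ => ?_
      simp only [AddMonoidHom.comp_apply, LinearMap.toAddMonoidHom_coe]
      ring
    simp_rw [hterm]
    rw [Finset.sum_comm]
    refine Finset.sum_eq_zero fun i _ => ?_
    rw [← Finset.mul_sum, ih _ (by simp only [List.length_cons] at hM ⊢; omega), mul_zero]

theorem IsPlanar.sum_pow_mul_pow_eq_zero (hp : p.Prime) (hK : Fintype.card K = p ^ n) {F : K → K}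
    (hF : IsPlanar F) {j k : ℕ} (hjk : 2 * (digitSum p j + digitSum p k) < n * (p - 1)) :
    ∑ x, F x ^ k * x ^ j = 0 := by
  have : Fact p.Prime := ⟨hp⟩
  have hchar : CharP K p := charP_of_card_eq_prime_pow hK
  let : Algebra (ZMod p) K := ZMod.algebra K p
  obtain ⟨l, hl, hlprod⟩ := exists_list_addMonoidHom_pow hp (K := K) j
  obtain ⟨m, hm, hmprod⟩ := exists_list_addMonoidHom_pow hp (K := K) k
  have h := hF.sum_prod_addMonoidHom_eq_zero hp hK
    ((m.map fun φ => φ.comp (AddMonoidHom.snd K K)) ++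
      l.map fun φ => φ.comp (AddMonoidHom.fst K K)) (by simp [hl, hm]; omega)
  rw [← h]
  refine Finset.sum_congr rfl fun x _ => ?_
  rw [hlprod, hmprod, List.map_append, List.prod_append, List.map_map, List.map_map]
  rfl

theorem IsPlanar.two_mul_algDeg_comp_le (hp : p.Prime) (hK : Fintype.card K = p ^ n) {F : K → K}
    (hF : IsPlanar F) (G : K → K) :
    2 * algDeg p (G ∘ F) ≤ 2 * algDeg p G + n * (p - 1) := by
  suffices h : algDeg p (G ∘ F) ≤ algDeg p G + n * (p - 1) / 2 by omega
  refine Finset.sup_le fun i hi => ?_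
  by_contra! hlt
  -- The exponent `0`, excluded from `coeff_interpPoly`, has digit sum `0` and cannot violate the
  -- bound.
  have hi0 : 0 < i := by
    rcases Nat.eq_zero_or_pos i with rfl | h
    · simp [digitSum_zero] at hlt
    · exact h
  have hiq := lt_card_of_mem_support_interpPoly hi
  obtain ⟨j, hj⟩ : ∃ j, i + j + 1 = Fintype.card K := ⟨Fintype.card K - 1 - i, by omega⟩
  have hsum := digitSum_add_digitSum hp.one_lt n i j (hj.trans hK)
  apply mem_support_iff.1 hi
  rw [coeff_interpPoly hi0 hj, neg_eq_zero]
  simp_rw [Function.comp_apply, eq_sum_coeff_interpPoly G, Finset.sum_mul, mul_assoc]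
  rw [Finset.sum_comm]
  refine Finset.sum_eq_zero fun k hk => ?_
  have hkG : digitSum p k ≤ algDeg p G := Finset.le_sup (f := digitSum p) hk
  rw [← Finset.mul_sum, hF.sum_pow_mul_pow_eq_zero hp hK (by omega), mul_zero]

end Planar

theorem theorem1 (p n : ℕ) (hp : p.Prime) {K : Type*} [Field K] [Fintype K]
    (hK : Fintype.card K = p ^ n) (F : K → K) (hF : IsPlanar F) (G : K → K) (hG : G ≠ 0) :
    (algDeg p (G ∘ F) : ℝ) - (algDeg p G : ℝ) ≤ (n : ℝ) * ((p : ℝ) - 1) / 2 := by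
  have h : ((2 * algDeg p (G ∘ F) : ℕ) : ℝ) ≤ ((2 * algDeg p G + n * (p - 1) : ℕ) : ℝ) :=
    Nat.cast_le.2 (hF.two_mul_algDeg_comp_le hp hK G)
  rw [Nat.cast_add, Nat.cast_mul, Nat.cast_mul, Nat.cast_mul, Nat.cast_sub hp.one_le] at h
  push_cast at h
  linarith
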